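/- Let $r\ge 1$. An $r$-Dyck path of length $n$ is a lattice path from $(0,0)$ to $(rn,n)$ with steps $(0,1)$ (written as the letter $0$) and $(1,0)$ (written as the letter $1$) that never goes below the line $y=x/r$; it is regarded as a word in $\{0,1\}$. Let $\mathcal P^r_n$ be the set of these paths. For a word $w=w_1w_2\cdots w_\ell$ in $\{0,1\}$ put $$\mathrm{Des}(w)=\{i : 1\le i<\ell,\ w_i>w_{i+1}\},\qquad \mathrm{maj}(w)=\sum_{i\in \mathrm{Des}(w)} i,$$ $$\alpha(w)=\sum_{i\in\mathrm{Des}(w)}|\{j\le i : w_j=0\}|,\qquad \beta(w)=\sum_{i\in\mathrm{Des}(w)}|\{j\le i: w_j=1\}|.$$ **Theorem.** Let $K$ be a commutative ring, let $a\in K$ be invertible and let $b\in K$ (for example $a,b$ indeterminates and $K=\mathbb Z[a,a^{-1},b]$). Let $(E_n(x))_{n\ge0}$ be a sequence of polynomials in $K[x]$ with $E_0(x)=1$. The following are equivalent. 1. For all $n\ge 0$, $\displaystyle E_n(x)=\sum_{d\in\mathcal P^r_n}x^{|\mathrm{Des}(d)|}a^{\alpha(d)}b^{\beta(d)}$. 2.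 In the ring $K[x][[z]]$ of formal power series, $$z=\sum_{n=1}^{\infty}\frac{a^{-\binom n2}E_n(x)\,z^n}{(1+a^{-1}z)\cdots(1+a^{-n}z)\,(1+xbz)\cdots(1+xb^{rn}z)}.$$ 3. For all $n\ge0$, $$E_{n+1}(x)=\sum_{n_0+n_1+\cdots+n_r=n}E_{n_0}(ax)\prod_{i=1}^{r}E_{n_i}\bigl(a^{d_1(i)}b^{d_2(i)}x\bigr)\bigl(a^{d_1(i)}b^{d_2(i)}x\bigr)^{\delta(n_i>0)},$$ where $n_0,\dots,n_r\ge0$, $\delta(P)$ is $1$ if $P$ is true and $0$ otherwise, and $$d_1(i)=1+\sum_{j=0}^{i-1}n_j,\qquad d_2(i)=i+r\sum_{j=0}^{i-1}n_j .$$ **Proposition.** Let $q\in K$ be invertible (for example an indeterminate, $K=\mathbb Z[q,q^{-1}]$), and put $(y;q)_m=(1-y)(1-qy)\cdots(1-q^{m-1}y)$. A sequence $(E_n(q))_{n\ge0}$ in $K$ with $E_0(q)=1$ satisfies, in $K[[z]]$, $$z=\sum_{n=1}^{\infty}\frac{E_n(q)\,z^n}{q^{\binom n2}(-q^{-n}z;q)_n(-qz;q)_{rn}}$$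 if and only if $\sum_{d\in\mathcal P^r_n}q^{\mathrm{maj}(d)}=E_n(q)$ for all $n\ge0$. Moreover, for every $q\in K$ and $n\ge0$, the polynomial in item 1 takes at $(a,b,x)=(q,q,1)$ the value $\sum_{d\in\mathcal P^r_n}q^{\mathrm{maj}(d)}$. -/

import Mathlib

noncomputable section

namespace RDyck

/-! ### Words and their statistics

Words in the letters `0` and `1` are lists over `Fin 2`; positions are counted from `1`. -/

/-- The descent set `{i : 1 ≤ i < |w|, w_i > w_{i+1}}` of a word `w = w_1 w_2 ...`
(the letter `w_i` is `w.getD (i - 1) 0`). -/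
def Des (w : List (Fin 2)) : Finset ℕ :=
  (Finset.Ico 1 w.length).filter fun i => w.getD i 0 < w.getD (i - 1) 0

/-- The major index: the sum of the descents. -/
def maj (w : List (Fin 2)) : ℕ := ∑ i ∈ Des w, i

/-- The sum over the descents `i` of the number of letters `0` among the first `i` letters. -/
def alpha (w : List (Fin 2)) : ℕ := ∑ i ∈ Des w, (w.take i).count 0

/-- The sum over the descents `i` of the number of letters `1` among the first `i` letters. -/
def beta (w : List (Fin 2)) : ℕ := ∑ i ∈ Des w, (w.take i).count 1

/-! ### `r`-Dyck paths -/

/-- The word `w` (`0` = up step, `1` = right step) is a lattice path from `(0,0)` to `(rn,n)`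
that never goes below the line `y = x / r`: after each number `i` of steps, the current
point `(x, y)` satisfies `x ≤ r * y`. -/
def IsDyckPath (r n : ℕ) (w : List (Fin 2)) : Prop :=
  w.count 0 = n ∧ w.count 1 = r * n ∧ ∀ i, (w.take i).count 1 ≤ r * (w.take i).count 0

theorem finite_isDyckPath (r n : ℕ) : {w | IsDyckPath r n w}.Finite := by
  refine (List.finite_length_eq (Fin 2) (n + r * n)).subset ?_
  rintro w ⟨h0, h1, -⟩
  have key : ∀ l : List (Fin 2), l.length = l.count 0 + l.count 1 := by
    intro l
    induction l with
    | nil => rfl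
    | cons c l ih => fin_cases c <;> simp [ih] <;> omega
  simp [key w, h0, h1]

/-- The finite set of `r`-Dyck paths of length `n`. -/
def dyckPaths (r n : ℕ) : Finset (List (Fin 2)) := (finite_isDyckPath r n).toFinset

/-! ### Formal power series -/

/-- The infinite series `∑ f n` of formal power series converges to `s` coefficientwise
(that is, each coefficient of the partial sums is eventually constant). -/
def HasFormalSum {R : Type*} [CommRing R] (f : ℕ → PowerSeries R) (s : PowerSeries R) : Prop :=
  letI : TopologicalSpace R := ⊥
  letI : TopologicalSpace (PowerSeries R) :=
    PowerSeries.WithPiTopology.instTopologicalSpace R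
  HasSum f s

/-- The quotient `f / g` of formal power series, for `g` with constant coefficient `1`. -/
def divSeries {R : Type*} [CommRing R] (f g : PowerSeries R) : PowerSeries R :=
  f * PowerSeries.invOfUnit g 1

/-- The `q`-Pochhammer symbol `(x; q)_n = (1 - x)(1 - q x) ⋯ (1 - q ^ (n - 1) x)`. -/
def qPochhammer {R : Type*} [CommRing R] (x q : R) (n : ℕ) : R :=
  ∏ i ∈ Finset.range n, (1 - q ^ i * x)

/-! ### The refined generating function

`x` is the polynomial variable, the coefficients lie in a commutative ring `K`. The elements
`a`, `b` of `K` may in particular be indeterminates, as for the ring of polynomials in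
`a, a⁻¹, b` over the integers. -/

variable {K : Type*} [CommRing K]

/-- The generating function
`∑_d x ^ |Des d| * a ^ α(d) * b ^ β(d)` over all `r`-Dyck paths `d` of length `n`. -/
def genFun (r n : ℕ) (a b : K) : Polynomial K :=
  ∑ d ∈ dyckPaths r n,
    Polynomial.X ^ (Des d).card * Polynomial.C (a ^ alpha d) * Polynomial.C (b ^ beta d)

/-- The denominator
`(1 + a⁻¹ z) ⋯ (1 + a⁻ⁿ z) * (1 + x b z) ⋯ (1 + x b ^ (r n) z)`,
a power series in `z` whose coefficients are polynomials in `x`. -/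
def expansionDenom (r n : ℕ) (a : Kˣ) (b : K) : PowerSeries (Polynomial K) :=
  (∏ i ∈ Finset.Icc 1 n,
    (1 + PowerSeries.C (Polynomial.C (((a⁻¹ ^ i : Kˣ) : K))) * PowerSeries.X)) *
  ∏ i ∈ Finset.Icc 1 (r * n),
    (1 + PowerSeries.C (Polynomial.X * Polynomial.C (b ^ i)) * PowerSeries.X)

/-- The `n`-th term of the expansion formula for `z`:
`a ^ (-(n choose 2)) * E_n(x) * z ^ n` over the denominator above. -/
def expansionTerm (r : ℕ) (a : Kˣ) (b : K) (E : ℕ → Polynomial K) (n : ℕ) :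
    PowerSeries (Polynomial K) :=
  divSeries
    (PowerSeries.C (Polynomial.C ((a⁻¹ ^ n.choose 2 : Kˣ) : K) * E n) * PowerSeries.X ^ n)
    (expansionDenom r n a b)

/-- The expansion formula `z = ∑_{n ≥ 1} (n-th term)`. -/
def SatisfiesExpansion (r : ℕ) (a : Kˣ) (b : K) (E : ℕ → Polynomial K) : Prop :=
  HasFormalSum (fun k => expansionTerm r a b E (k + 1)) PowerSeries.X

/-- The substitution `x ↦ c * x` in a polynomial in `x`. -/
def scaleVar (c : K) (P : Polynomial K) : Polynomial K :=
  P.comp (Polynomial.C c * Polynomial.X)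

/-- `d₁(i) = 1 + n_0 + ⋯ + n_{i-1}`. -/
def d1 {r : ℕ} (m : Fin (r + 1) → ℕ) (i : Fin (r + 1)) : ℕ :=
  1 + ∑ j ∈ Finset.univ.filter (· < i), m j

/-- `d₂(i) = i + r * (n_0 + ⋯ + n_{i-1})`. -/
def d2 {r : ℕ} (m : Fin (r + 1) → ℕ) (i : Fin (r + 1)) : ℕ :=
  (i : ℕ) + r * ∑ j ∈ Finset.univ.filter (· < i), m j

/-- The recurrence: for all `n`, `E_{n+1}(x)` is the sum over all `(n_0, ..., n_r)` with
`n_0 + ⋯ + n_r = n` of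
`E_{n_0}(a x) * ∏_{i=1}^r E_{n_i}(c_i x) * (c_i x) ^ δ(n_i > 0)`,
where `c_i = a ^ d₁(i) * b ^ d₂(i)`. The index `i = 1, ..., r` is `i.succ` with `i : Fin r`. -/
def SatisfiesRecurrence (r : ℕ) (a b : K) (E : ℕ → Polynomial K) : Prop :=
  ∀ n, E (n + 1) =
    ∑ m ∈ Finset.Nat.antidiagonalTuple (r + 1) n,
      scaleVar a (E (m 0)) *
        ∏ i : Fin r,
          (scaleVar (a ^ d1 m i.succ * b ^ d2 m i.succ) (E (m i.succ)) *
            (Polynomial.C (a ^ d1 m i.succ * b ^ d2 m i.succ) * Polynomial.X) ^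
              (if 0 < m i.succ then 1 else 0))

/-! ### The `q`-analogue of the Fuss–Catalan numbers -/

/-- The expansion formula that defines the numbers `e_n = E_n(q)`:
`z = ∑_{n ≥ 1} e_n z ^ n / (q ^ (n choose 2) * (-q⁻ⁿ z; q)_n * (-q z; q)_{r n})`. -/
def SatisfiesQExpansion (r : ℕ) (q : Kˣ) (e : ℕ → K) : Prop :=
  HasFormalSum
    (fun k =>
      let n := k + 1
      divSeries
        (PowerSeries.C (((q⁻¹ ^ n.choose 2 : Kˣ) : K) * e n) * PowerSeries.X ^ n)
        (qPochhammer (-(PowerSeries.C ((q⁻¹ ^ n : Kˣ) : K) * PowerSeries.X))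
            (PowerSeries.C (q : K)) n *
          qPochhammer (-(PowerSeries.C (q : K) * PowerSeries.X))
            (PowerSeries.C (q : K)) (r * n)))
    PowerSeries.X

end RDyck

end

/-!
The weight `x ^ |Des w| * a ^ α(w) * b ^ β(w)` can be computed letter by letter: reading `0`
replaces `x` by `a x`, reading `1` replaces `x` by `b x`, and a descent contributes the current
value of `x`.

A nonempty Dyck path is uniquely of the form `0 d₀ 1 d₁ ⋯ 1 dᵣ` with Dyck paths `dᵢ` (cut it
where `r y - x` first drops below `r`, `r - 1`, …, `1`), and multiplying the weights of the pieces
gives the recurrence.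

For the expansion, let `T i j` be the sum of the weights of the words with `i` letters `0` and `j`
letters `1` that stay above the boundary, and `Z i j` the same sum with `0` appended to each word.
Removing the last letter expresses `T (i + 1)` and `Z (i + 1)` through `Z i`. For the row sums
`S i = ∑ j, Z i j / ((1 + x b z) ⋯ (1 + x b ^ j z))` this says that `z S (i + 1)` is
`(z + a ^ (i + 1)) S i` minus a multiple of `T (i + 1) (r (i + 1)) = E_{i+1}`, so the expansion
telescopes; the remainder after `n` summands is divisible by `z ^ (n + 1)`.

Conversely, both the recurrence and the expansion determine `E_n` from the earlier `E_k`. Since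
`maj = α + β`, the statement on `maj` is the case `a = b = q`, `x = 1`: the argument for the
expansion does not need `x` to be a polynomial variable.
-/

namespace RDyck

/-! ### Ballot words -/

/-- The words each prefix of which has at most `k` more letters `1` than `r` times its number of
letters `0`. The offset `k` makes this notion stable under removing the first letter. -/
def IsBallot (r k : ℕ) (w : List (Fin 2)) : Prop :=
  ∀ m, (w.take m).count 1 ≤ r * (w.take m).count 0 + k

section Ballot

variable {r k l i j n : ℕ} {u v w : List (Fin 2)}

theorem IsBallot.count_one_le (h : IsBallot r k w) : w.count 1 ≤ r * w.count 0 + k := by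
  simpa using h w.length

theorem IsBallot.mono (h : IsBallot r k w) (hkl : k ≤ l) : IsBallot r l w :=
  fun m => (h m).trans (by gcongr)

@[simp]
theorem isBallot_nil : IsBallot r k [] := by
  simp [IsBallot]

@[simp]
theorem isBallot_cons_zero : IsBallot r k (0 :: w) ↔ IsBallot r (k + r) w := by
  rw [IsBallot, ← Nat.and_forall_add_one]
  simp [IsBallot, mul_add, add_assoc, add_comm r]

@[simp]
theorem not_isBallot_zero_cons_one : ¬IsBallot r 0 (1 :: w) :=
  fun h => by simpa using h 1

@[simp]
theorem isBallot_succ_cons_one : IsBallot r (k + 1) (1 :: w) ↔ IsBallot r k w := by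
  rw [IsBallot, ← Nat.and_forall_add_one]
  simp [IsBallot, ← add_assoc]

theorem isBallot_append (h : u.count 1 + l = r * u.count 0 + k) :
    IsBallot r k (u ++ v) ↔ IsBallot r k u ∧ IsBallot r l v := by
  induction u generalizing k with
  | nil => simp_all
  | cons c u ih =>
    match c, k with
    | 0, k => simpa using ih (by grind)
    | 1, 0 => simp
    | 1, k + 1 => simpa using ih (by grind)

@[simp]
theorem isBallot_concat_zero : IsBallot r k (u ++ [0]) ↔ IsBallot r k u := by
  induction u generalizing k with
  | nil => simp
  | cons c u ih =>
    match c, k with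
    | 0, k => simpa using ih
    | 1, 0 => simp
    | 1, k + 1 => simpa using ih

theorem isBallot_concat_one :
    IsBallot r k (u ++ [1]) ↔ IsBallot r k u ∧ u.count 1 < r * u.count 0 + k := by
  induction u generalizing k with
  | nil => cases k <;> simp
  | cons c u ih =>
    match c, k with
    | 0, k => simp [ih, mul_add, add_comm k, add_assoc]
    | 1, 0 => simp
    | 1, k + 1 => simp [ih, ← add_assoc]

theorem isBallot_append_one_cons (hu : IsBallot r 0 u) (hbal : u.count 1 = r * u.count 0) :
    IsBallot r (k + 1) (u ++ 1 :: v) ↔ IsBallot r k v := by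
  simp [isBallot_append (congrArg (· + (k + 1)) hbal), hu.mono (Nat.zero_le (k + 1))]

theorem exists_eq_append_one_cons_of_not_isBallot (h : ¬IsBallot r k w) :
    ∃ u v, w = u ++ 1 :: v ∧ IsBallot r k u ∧ u.count 1 = r * u.count 0 + k := by
  induction w generalizing k with
  | nil => simp at h
  | cons c w ih =>
    match c, k with
    | 0, k =>
      obtain ⟨u, v, rfl, hu, hcount⟩ := ih (isBallot_cons_zero.not.mp h)
      exact ⟨0 :: u, v, rfl, isBallot_cons_zero.mpr hu, by grind⟩
    | 1, 0 => exact ⟨[], w, by simp⟩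
    | 1, k + 1 =>
      obtain ⟨u, v, rfl, hu, hcount⟩ := ih (isBallot_succ_cons_one.not.mp h)
      exact ⟨1 :: u, v, rfl, isBallot_succ_cons_one.mpr hu, by grind⟩

theorem append_one_cons_inj_of_isBallot {u' v' : List (Fin 2)}
    (hu : IsBallot r k u) (hcount : u.count 1 = r * u.count 0 + k)
    (hu' : IsBallot r k u') (hcount' : u'.count 1 = r * u'.count 0 + k)
    (heq : u ++ 1 :: v = u' ++ 1 :: v') : u = u' ∧ v = v' := by
  have not_isBallot {u t : List (Fin 2)} (h : u.count 1 = r * u.count 0 + k) :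
      ¬IsBallot r k (u ++ 1 :: t) := by
    simp [isBallot_append (l := 0) h]
  rcases List.append_eq_append_iff.mp heq with ⟨_ | ⟨c, t⟩, rfl, ht⟩ | ⟨_ | ⟨c, t⟩, rfl, ht⟩
  · simpa using ht
  · obtain ⟨rfl, -⟩ := List.cons.inj ht
    exact absurd hu' (not_isBallot hcount)
  · simpa using ht.symm
  · obtain ⟨rfl, -⟩ := List.cons.inj ht
    exact absurd hu (not_isBallot hcount')

/-! ### Sums over ballot words -/

theorem length_eq_count_add_count (w : List (Fin 2)) : w.length = w.count 0 + w.count 1 := by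
  simpa using (Multiset.sum_count_eq_card (m := (w : Multiset (Fin 2)))
    fun c _ => Finset.mem_univ c).symm

theorem eq_replicate_zero_iff : w = List.replicate i 0 ↔ w.count 0 = i ∧ w.count 1 = 0 := by
  constructor
  · rintro rfl
    simp [List.count_replicate]
  · rintro ⟨h0, h1⟩
    rw [List.eq_replicate_iff, length_eq_count_add_count, h0, h1]
    refine ⟨rfl, fun c hc => ?_⟩
    fin_cases c
    · rfl
    · exact absurd hc (List.count_eq_zero.mp h1)

theorem finite_ballotWords (r k i j : ℕ) :
    {w | w.count 0 = i ∧ w.count 1 = j ∧ IsBallot r k w}.Finite :=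
  (List.finite_length_eq (Fin 2) (i + j)).subset fun w ⟨h0, h1, _⟩ => by
    simp [length_eq_count_add_count w, h0, h1]

variable (r k i j) in
/-- The ballot words with `i` letters `0` and `j` letters `1`. -/
noncomputable def ballotWords : Finset (List (Fin 2)) :=
  (finite_ballotWords r k i j).toFinset

theorem mem_ballotWords :
    w ∈ ballotWords r k i j ↔ w.count 0 = i ∧ w.count 1 = j ∧ IsBallot r k w := by
  simp [ballotWords]

theorem dyckPaths_eq_ballotWords : dyckPaths r n = ballotWords r 0 n (r * n) := by
  ext w
  simp [dyckPaths, mem_ballotWords, IsDyckPath, IsBallot]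

theorem ballotWords_eq_empty (h : r * i + k < j) : ballotWords r k i j = ∅ := by
  refine Finset.eq_empty_of_forall_notMem fun w hw => ?_
  obtain ⟨rfl, rfl, hballot⟩ := mem_ballotWords.mp hw
  exact hballot.count_one_le.not_gt h

theorem ballotWords_zero_right : ballotWords r k i 0 = {List.replicate i 0} := by
  ext w
  rw [mem_ballotWords, Finset.mem_singleton, eq_replicate_zero_iff, ← and_assoc,
    and_iff_left_iff_imp]
  rintro ⟨-, h1⟩ m
  have := (List.take_sublist m w).count_le 1
  omega

theorem concat_zero_mem_ballotWords :
    u ++ [0] ∈ ballotWords r k (i + 1) j ↔ u ∈ ballotWords r k i j := by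
  simp [mem_ballotWords]

theorem concat_one_mem_ballotWords (hj : j < r * i + k) :
    u ++ [1] ∈ ballotWords r k i (j + 1) ↔ u ∈ ballotWords r k i j := by
  simp only [mem_ballotWords, isBallot_concat_one]
  constructor
  · simp +contextual
  · rintro ⟨rfl, rfl, hu⟩
    simp_all

theorem ballotWords_succ_succ (hj : j < r * (i + 1) + k) :
    ballotWords r k (i + 1) (j + 1) = (ballotWords r k i (j + 1)).image (· ++ [0]) ∪
      (ballotWords r k (i + 1) j).image (· ++ [1]) := by
  ext w
  rcases w.eq_nil_or_concat' with rfl | ⟨u, c, rfl⟩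
  · simp [mem_ballotWords]
  · fin_cases c
    · simp [concat_zero_mem_ballotWords]
    · simp [concat_one_mem_ballotWords hj]

theorem sum_ballotWords_succ_succ {M : Type*} [AddCommMonoid M] (hj : j < r * (i + 1) + k)
    (f : List (Fin 2) → M) :
    ∑ w ∈ ballotWords r k (i + 1) (j + 1), f w =
      ∑ w ∈ ballotWords r k i (j + 1), f (w ++ [0]) +
        ∑ w ∈ ballotWords r k (i + 1) j, f (w ++ [1]) := by
  have hdisj : Disjoint ((ballotWords r k i (j + 1)).image (· ++ [0]))
      ((ballotWords r k (i + 1) j).image (· ++ [1])) := by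
    simp [Finset.disjoint_left]
  rw [ballotWords_succ_succ hj, Finset.sum_union hdisj,
    Finset.sum_image (List.append_left_injective _).injOn,
    Finset.sum_image (List.append_left_injective _).injOn]

theorem sum_dyckPaths_succ {M : Type*} [AddCommMonoid M] (f : List (Fin 2) → M) :
    ∑ w ∈ dyckPaths r (n + 1), f w = ∑ w ∈ ballotWords r r n (r * n + r), f (0 :: w) := by
  rw [← Finset.sum_image (g := (0 :: ·)) List.cons_injective.injOn]
  refine Finset.sum_congr ?_ fun _ _ => rfl
  ext w
  match w with
  | [] => simp [dyckPaths_eq_ballotWords, mem_ballotWords]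
  | 0 :: w => simp [dyckPaths_eq_ballotWords, mem_ballotWords, mul_add]
  | 1 :: w => simp [dyckPaths_eq_ballotWords, mem_ballotWords]

theorem sum_ballotWords_first_passage {M : Type*} [AddCommMonoid M] (f : List (Fin 2) → M) :
    ∑ w ∈ ballotWords r (k + 1) n (r * n + (k + 1)), f w =
      ∑ pq ∈ Finset.HasAntidiagonal.antidiagonal n, ∑ u ∈ dyckPaths r pq.1,
        ∑ v ∈ ballotWords r k pq.2 (r * pq.2 + k), f (u ++ 1 :: v) := by
  simp_rw [← Finset.sum_product', Finset.sum_sigma', dyckPaths_eq_ballotWords]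
  symm
  refine Finset.sum_bij (fun s _ => s.2.1 ++ 1 :: s.2.2) ?_ ?_ ?_ fun _ _ => rfl
  · rintro ⟨⟨p, q⟩, u, v⟩ hs
    simp only [Finset.mem_sigma, Finset.HasAntidiagonal.mem_antidiagonal, Finset.mem_product,
      mem_ballotWords] at hs ⊢
    obtain ⟨rfl, ⟨rfl, hu1, hu⟩, rfl, hv1, hv⟩ := hs
    exact ⟨by simp, by grind, (isBallot_append_one_cons hu hu1).mpr hv⟩
  · rintro ⟨⟨p, q⟩, u, v⟩ hs ⟨⟨p', q'⟩, u', v'⟩ hs' heq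
    simp only [Finset.mem_sigma, Finset.HasAntidiagonal.mem_antidiagonal, Finset.mem_product,
      mem_ballotWords] at hs hs'
    obtain ⟨-, ⟨rfl, hu1, hu⟩, rfl, -⟩ := hs
    obtain ⟨-, ⟨rfl, hu1', hu'⟩, rfl, -⟩ := hs'
    obtain ⟨rfl, rfl⟩ := append_one_cons_inj_of_isBallot hu hu1 hu' hu1' heq
    rfl
  · intro w hw
    obtain ⟨rfl, hw1, hw⟩ := mem_ballotWords.mp hw
    have hw_not : ¬IsBallot r 0 w := fun h => by have := h.count_one_le; omega
    obtain ⟨u, v, rfl, hu, hu1⟩ := exists_eq_append_one_cons_of_not_isBallot hw_not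
    have hv1 : v.count 1 = r * v.count 0 + k := by grind
    refine ⟨⟨(u.count 0, v.count 0), u, v⟩, ?_, rfl⟩
    simp [mem_ballotWords, hu, hu1, hv1, (isBallot_append_one_cons hu hu1).mp hw]

end Ballot

/-! ### The weight of a word -/

/-- The contribution to `x ^ |Des| * a ^ α * b ^ β` of the word `w` when it is read after the
letter `p`. Reading a letter rescales `x`, so that a descent always contributes the current
value of `x`. -/
def descentWeight {R : Type*} [CommRing R] (a b : R) : R → Fin 2 → List (Fin 2) → R
  | _, _, [] => 1
  | x, p, c :: w => (if c < p then x else 1) * descentWeight a b (![a, b] c * x) c w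

section Weight

variable {R : Type*} [CommRing R] (a b x : R) (p : Fin 2) (u v w : List (Fin 2))
  (r k i j n : ℕ)

theorem descentWeight_append :
    descentWeight a b x p (u ++ v) = descentWeight a b x p u *
      descentWeight a b (a ^ u.count 0 * b ^ u.count 1 * x) (u.getLastD p) v := by
  induction u generalizing x p with
  | nil => simp [descentWeight]
  | cons c u ih =>
    have hcount : a ^ (c :: u).count 0 * b ^ (c :: u).count 1 * x =
        a ^ u.count 0 * b ^ u.count 1 * (![a, b] c * x) := by
      fin_cases c <;> simp [pow_succ, mul_assoc, mul_left_comm]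
    rw [List.cons_append, descentWeight, descentWeight, ih, List.getLastD_cons, hcount,
      mul_assoc (ite _ _ _)]

theorem descentWeight_concat_one :
    descentWeight a b x p (u ++ [1]) = descentWeight a b x p u := by
  have h : ¬1 < u.getLastD p := (Fin.le_last _).not_gt
  rw [descentWeight_append, descentWeight, if_neg h, descentWeight, one_mul, mul_one]

theorem descentWeight_concat_zero_concat_zero :
    descentWeight a b x p (u ++ [0] ++ [0]) = descentWeight a b x p (u ++ [0]) := by
  rw [descentWeight_append a b x p (u ++ [0])]
  simp [descentWeight]

theorem descentWeight_concat_one_concat_zero :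
    descentWeight a b x p (u ++ [1] ++ [0]) =
      a ^ u.count 0 * b ^ (u.count 1 + 1) * x * descentWeight a b x p u := by
  rw [descentWeight_append, descentWeight_concat_one, mul_comm]
  simp [descentWeight]

theorem descentWeight_append_one_cons :
    descentWeight a b x p (u ++ 1 :: v) = descentWeight a b x p u *
      descentWeight a b (a ^ u.count 0 * b ^ (u.count 1 + 1) * x) 1 v := by
  rw [List.append_cons, descentWeight_append, descentWeight_concat_one]
  simp

theorem descentWeight_replicate_zero : descentWeight a b x 0 (List.replicate n 0) = 1 := by
  induction n generalizing x with
  | zero => rfl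
  | succ n ih => simp [List.replicate_succ, descentWeight, ih]

theorem prod_Des_cons :
    ∏ i ∈ Des (p :: w), a ^ ((p :: w).take i).count 0 * b ^ ((p :: w).take i).count 1 * x =
      descentWeight a b (![a, b] p * x) p w := by
  rw [Des, Finset.prod_filter, Finset.prod_Ico_eq_prod_range]
  induction w generalizing p x with
  | nil => simp [descentWeight]
  | cons c w ih =>
    rw [descentWeight, ← ih, List.length_cons, Nat.add_sub_cancel, List.length_cons,
      Finset.prod_range_succ', mul_comm]
    congr 1
    · fin_cases p <;> simp
    · refine Finset.prod_congr rfl fun k _ => ?_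
      rw [show 1 + (k + 1) = k + 1 + 1 by ring, add_comm 1 k]
      simp only [List.getD_cons_succ, Nat.add_sub_cancel, List.take_succ_cons]
      fin_cases p <;> simp [pow_succ, mul_assoc, mul_left_comm]

theorem pow_card_Des_mul_pow_alpha_mul_pow_beta :
    x ^ (Des w).card * a ^ alpha w * b ^ beta w = descentWeight a b x 0 w := by
  have hprod : x ^ (Des w).card * a ^ alpha w * b ^ beta w =
      ∏ i ∈ Des w, a ^ (w.take i).count 0 * b ^ (w.take i).count 1 * x := by
    rw [Finset.prod_mul_distrib, Finset.prod_mul_distrib, Finset.prod_pow_eq_pow_sum,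
      Finset.prod_pow_eq_pow_sum, Finset.prod_const, alpha, beta]
    ring
  rw [hprod]
  match w with
  | [] => simp [Des, descentWeight]
  | c :: w => simp [prod_Des_cons, descentWeight]

/-! ### The recurrence -/

/-- The value at `x` of the generating function `genFun`, for parameters `a`, `b`, `x` in an
arbitrary commutative ring. -/
noncomputable def dyckSum : R :=
  ∑ d ∈ dyckPaths r n, x ^ (Des d).card * a ^ alpha d * b ^ beta d

/-- The sum of the weights of the ballot words with `i` letters `0` and `j` letters `1`, read
after the letter `p`. -/
noncomputable def ballotSum : R :=
  ∑ w ∈ ballotWords r k i j, descentWeight a b x p w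

theorem dyckSum_eq_ballotSum : dyckSum a b x r n = ballotSum a b x 0 r 0 n (r * n) := by
  simp only [dyckSum, ballotSum, dyckPaths_eq_ballotWords,
    pow_card_Des_mul_pow_alpha_mul_pow_beta]

theorem ballotSum_zero_right : ballotSum a b x 0 r k i 0 = 1 := by
  rw [ballotSum, ballotWords_zero_right, Finset.sum_singleton, descentWeight_replicate_zero]

theorem dyckSum_zero : dyckSum a b x r 0 = 1 := by
  rw [dyckSum_eq_ballotSum, mul_zero, ballotSum_zero_right]

/-- A nonempty Dyck path starts with `0`, which creates a descent after a letter `1`. -/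
theorem ballotSum_one_eq_dyckSum_mul :
    ballotSum a b x 1 r 0 n (r * n) = dyckSum a b x r n * x ^ (if 0 < n then 1 else 0) := by
  rw [ballotSum, ← dyckPaths_eq_ballotWords, dyckSum_eq_ballotSum, ballotSum,
    ← dyckPaths_eq_ballotWords]
  match n with
  | 0 => simp [dyckPaths_eq_ballotWords, ballotWords_zero_right, descentWeight]
  | n + 1 =>
    simp [sum_dyckPaths_succ, descentWeight, ← Finset.mul_sum, mul_comm]

theorem ballotSum_first_passage :
    ballotSum a b x p r (k + 1) n (r * n + (k + 1)) =
      ∑ lm ∈ Finset.HasAntidiagonal.antidiagonal n,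
        ballotSum a b x p r 0 lm.1 (r * lm.1) *
          ballotSum a b (a ^ lm.1 * b ^ (r * lm.1 + 1) * x) 1 r k lm.2 (r * lm.2 + k) := by
  rw [ballotSum, sum_ballotWords_first_passage]
  refine Finset.sum_congr rfl fun lm _ => ?_
  rw [ballotSum, ballotSum, Finset.sum_mul_sum, dyckPaths_eq_ballotWords]
  refine Finset.sum_congr rfl fun u hu => Finset.sum_congr rfl fun v _ => ?_
  obtain ⟨h0, h1, -⟩ := mem_ballotWords.mp hu
  rw [descentWeight_append_one_cons, h0, h1]

theorem sum_antidiagonalTuple_succ {M : Type*} [AddCommMonoid M] (f : (Fin (k + 1) → ℕ) → M) :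
    ∑ m ∈ Finset.Nat.antidiagonalTuple (k + 1) n, f m =
      ∑ lm ∈ Finset.HasAntidiagonal.antidiagonal n,
        ∑ m ∈ Finset.Nat.antidiagonalTuple k lm.2, f (Fin.cons lm.1 m) := by
  rw [Finset.sum_sigma']
  refine Finset.sum_bij' (fun m _ => ⟨(m 0, ∑ i : Fin k, m i.succ), Fin.tail m⟩)
    (fun s _ => Fin.cons s.1.1 s.2) ?_ ?_ ?_ ?_ ?_
  all_goals simp +contextual [Finset.Nat.mem_antidiagonalTuple, Fin.sum_univ_succ, Fin.tail]

theorem sum_filter_lt_succ (m : Fin (k + 1) → ℕ) (t : Fin k) :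
    ∑ s with s < t.succ, m s = m 0 + ∑ s with s < t, m s.succ := by
  simp [Finset.sum_filter, Fin.sum_univ_succ]

/-- Cutting at the first passages above each boundary line splits a word with surplus `k` into
`k + 1` Dyck paths. -/
theorem ballotSum_eq_sum_antidiagonalTuple :
    ballotSum a b x p r k n (r * n + k) = ∑ m ∈ Finset.Nat.antidiagonalTuple (k + 1) n,
      ballotSum a b x p r 0 (m 0) (r * m 0) * ∏ t : Fin k,
        ballotSum a b
          (a ^ (∑ s with s < t.succ, m s) * b ^ (t + 1 + r * ∑ s with s < t.succ, m s) * x)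
          1 r 0 (m t.succ) (r * m t.succ) := by
  induction k generalizing n x p with
  | zero => simp
  | succ k ih =>
    rw [ballotSum_first_passage, sum_antidiagonalTuple_succ]
    refine Finset.sum_congr rfl fun lm _ => ?_
    rw [ih, Finset.mul_sum]
    refine Finset.sum_congr rfl fun m _ => ?_
    rw [Fin.prod_univ_succ]
    simp only [sum_filter_lt_succ _ _ (Fin.succ _), Fin.cons_succ, Fin.cons_zero]
    congr! 3 with t
    · rw [sum_filter_lt_succ]
      simp [add_comm]
    · rw [Fin.val_succ]
      congr 1
      ring

theorem dyckSum_succ :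
    dyckSum a b x r (n + 1) = ∑ m ∈ Finset.Nat.antidiagonalTuple (r + 1) n,
      dyckSum a b (a * x) r (m 0) * ∏ i : Fin r,
        (dyckSum a b (a ^ d1 m i.succ * b ^ d2 m i.succ * x) r (m i.succ) *
          (a ^ d1 m i.succ * b ^ d2 m i.succ * x) ^ (if 0 < m i.succ then 1 else 0)) := by
  have hfirst : dyckSum a b x r (n + 1) = ballotSum a b (a * x) 0 r r n (r * n + r) := by
    rw [dyckSum_eq_ballotSum, ballotSum, ← dyckPaths_eq_ballotWords, sum_dyckPaths_succ]
    simp [ballotSum, descentWeight]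
  rw [hfirst, ballotSum_eq_sum_antidiagonalTuple]
  have hscale (s t : ℕ) : a ^ s * b ^ t * (a * x) = a ^ (1 + s) * b ^ t * x := by ring
  simp only [← dyckSum_eq_ballotSum, ballotSum_one_eq_dyckSum_mul, d1, d2, Fin.val_succ, hscale]

end Weight

/-! ### Formal sums -/

section Series

open PowerSeries

variable {R : Type*} [CommRing R]

theorem hasFormalSum_iff {f : ℕ → R⟦X⟧} {s : R⟦X⟧} (h : ∀ k, X ^ (k + 1) ∣ f k) :
    HasFormalSum f s ↔ ∀ d, ∑ k ∈ Finset.range d, coeff d (f k) = coeff d s := by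
  unfold HasFormalSum
  let _ : TopologicalSpace R := ⊥
  have : DiscreteTopology R := ⟨rfl⟩
  rw [WithPiTopology.hasSum_iff_hasSum_coeff]
  refine forall_congr' fun d => ?_
  have hsum : HasSum (fun k => coeff d (f k)) (∑ k ∈ Finset.range d, coeff d (f k)) := by
    refine hasSum_sum_of_ne_finset_zero fun k hk => X_pow_dvd_iff.mp (h k) d ?_
    exact Nat.lt_succ_of_le (not_lt.mp (Finset.mem_range.not.mp hk))
  exact ⟨hsum.unique, fun h => h ▸ hsum⟩

theorem HasFormalSum.eq_of_isRegular {e e' : ℕ → R} {g : ℕ → R⟦X⟧} {s : R⟦X⟧}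
    (hg : ∀ k, IsRegular (constantCoeff (g k)))
    (h : HasFormalSum (fun k => C (e k) * X ^ (k + 1) * g k) s)
    (h' : HasFormalSum (fun k => C (e' k) * X ^ (k + 1) * g k) s) : e = e' := by
  rw [hasFormalSum_iff fun k => dvd_mul_of_dvd_left (dvd_mul_left _ _) _] at h h'
  funext n
  induction n using Nat.strong_induction_on with
  | _ n ih =>
    have hn := (h (n + 1)).trans (h' (n + 1)).symm
    rw [Finset.sum_range_succ, Finset.sum_range_succ,
      Finset.sum_congr rfl fun k hk => by rw [ih k (Finset.mem_range.mp hk)]] at hn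
    have hcoeff (c : R) : coeff (n + 1) (C c * X ^ (n + 1) * g n) = c * constantCoeff (g n) := by
      rw [mul_assoc, coeff_C_mul, coeff_X_pow_mul', if_pos le_rfl, Nat.sub_self,
        coeff_zero_eq_constantCoeff_apply]
    exact (hg n).right (by simpa only [hcoeff] using add_left_cancel hn)

theorem divSeries_eq_iff {f g y : R⟦X⟧} (hg : constantCoeff g = 1) :
    divSeries f g = y ↔ f = y * g := by
  have hinv : g * invOfUnit g 1 = 1 := mul_invOfUnit g 1 hg
  constructor
  · rintro rfl
    rw [divSeries, mul_assoc, mul_comm _ g, hinv, mul_one]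
  · rintro rfl
    rw [divSeries, mul_assoc, hinv, mul_one]

/-- The reciprocal of `(1 + c₁ z) ⋯ (1 + cₙ z)`. -/
noncomputable def invProd (c : ℕ → R) (n : ℕ) : R⟦X⟧ :=
  divSeries 1 (∏ i ∈ Finset.Icc 1 n, (1 + C (c i) * X))

variable (c c' : ℕ → R) (m n : ℕ)

theorem constantCoeff_prod_one_add :
    constantCoeff (∏ i ∈ Finset.Icc 1 n, (1 + C (c i) * X)) = 1 := by
  simp

theorem invProd_mul_prod : invProd c n * ∏ i ∈ Finset.Icc 1 n, (1 + C (c i) * X) = 1 :=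
  ((divSeries_eq_iff (constantCoeff_prod_one_add c n)).mp rfl).symm

theorem invProd_zero : invProd c 0 = 1 := by
  simpa using invProd_mul_prod c 0

theorem invProd_succ_mul : invProd c (n + 1) * (1 + C (c (n + 1)) * X) = invProd c n := by
  symm
  rw [invProd, divSeries_eq_iff (constantCoeff_prod_one_add c n), mul_assoc,
    mul_comm (1 + _), ← Finset.prod_Icc_succ_top (Nat.le_add_left 1 n), invProd_mul_prod]

theorem constantCoeff_invProd : constantCoeff (invProd c n) = 1 := by
  simpa using congrArg constantCoeff (invProd_mul_prod c n)

theorem divSeries_prod_mul_prod (f : R⟦X⟧) :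
    divSeries f ((∏ i ∈ Finset.Icc 1 m, (1 + C (c i) * X)) *
      ∏ i ∈ Finset.Icc 1 n, (1 + C (c' i) * X)) = f * (invProd c m * invProd c' n) := by
  rw [divSeries_eq_iff (by simp), mul_assoc, mul_mul_mul_comm, invProd_mul_prod,
    invProd_mul_prod, mul_one, mul_one]

end Series

/-! ### Sums over rows -/

section Row

open PowerSeries

variable {R : Type*} [CommRing R] (a b x : R) (r i j m : ℕ)

/-- The sum of the weights of the words obtained by appending `0` to the ballot words with `i`
letters `0` and `j` letters `1`. -/
noncomputable def ballotSumConcatZero : R :=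
  ∑ w ∈ ballotWords r 0 i j, descentWeight a b x 0 (w ++ [0])

theorem ballotSumConcatZero_zero_right : ballotSumConcatZero a b x r i 0 = 1 := by
  rw [ballotSumConcatZero, ballotWords_zero_right, Finset.sum_singleton, ← List.replicate_succ',
    descentWeight_replicate_zero]

variable {i j m}

theorem ballotSumConcatZero_eq_zero (h : r * i < j) : ballotSumConcatZero a b x r i j = 0 := by
  rw [ballotSumConcatZero, ballotWords_eq_empty h, Finset.sum_empty]

variable {r}

theorem ballotSum_succ_succ (hj : j < r * (i + 1)) :
    ballotSum a b x 0 r 0 (i + 1) (j + 1) =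
      ballotSumConcatZero a b x r i (j + 1) + ballotSum a b x 0 r 0 (i + 1) j := by
  rw [ballotSum, sum_ballotWords_succ_succ hj]
  simp only [descentWeight_concat_one, ballotSumConcatZero, ballotSum]

theorem ballotSumConcatZero_succ_succ (hj : j < r * (i + 1)) :
    ballotSumConcatZero a b x r (i + 1) (j + 1) = ballotSumConcatZero a b x r i (j + 1) +
      a ^ (i + 1) * b ^ (j + 1) * x * ballotSum a b x 0 r 0 (i + 1) j := by
  rw [ballotSumConcatZero, sum_ballotWords_succ_succ hj, ballotSum, Finset.mul_sum]
  simp only [descentWeight_concat_zero_concat_zero, ballotSumConcatZero]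
  congr! 2 with w hw
  obtain ⟨h0, h1, -⟩ := mem_ballotWords.mp hw
  rw [descentWeight_concat_one_concat_zero, h0, h1]

variable (r i m)

/-- The sum over `j ≤ m` of the sums `ballotSumConcatZero` of row `i`, each divided by
`(1 + x b z) ⋯ (1 + x b ^ j z)`. -/
noncomputable def rowSum : R⟦X⟧ :=
  ∑ j ∈ Finset.range (m + 1),
    invProd (fun l => x * b ^ l) j * C (ballotSumConcatZero a b x r i j)

theorem rowSum_zero_right : rowSum a b x r i 0 = 1 := by
  simp [rowSum, ballotSumConcatZero_zero_right, invProd_zero]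

theorem rowSum_succ : rowSum a b x r i (m + 1) = rowSum a b x r i m +
    invProd (fun l => x * b ^ l) (m + 1) * C (ballotSumConcatZero a b x r i (m + 1)) :=
  Finset.sum_range_succ _ _

variable {r i m}

theorem rowSum_eq_of_le (h : r * i ≤ m) : rowSum a b x r i m = rowSum a b x r i (r * i) := by
  induction m, h using Nat.le_induction with
  | base => rfl
  | succ m h ih =>
    rw [rowSum_succ, ih, ballotSumConcatZero_eq_zero a b x r (Nat.lt_succ_of_le h), map_zero,
      mul_zero, add_zero]

theorem X_mul_rowSum_succ (h : m ≤ r * (i + 1)) :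
    X * rowSum a b x r (i + 1) m = (X + C (a ^ (i + 1))) * rowSum a b x r i m -
      C (a ^ (i + 1)) * invProd (fun l => x * b ^ l) m * C (ballotSum a b x 0 r 0 (i + 1) m) := by
  induction m with
  | zero => simp [rowSum_zero_right, ballotSum_zero_right, invProd_zero]
  | succ m ih =>
    have hprod := invProd_succ_mul (fun l => x * b ^ l) m
    rw [rowSum_succ, rowSum_succ, mul_add, ih (Nat.le_of_succ_le h), ← hprod,
      ballotSum_succ_succ a b x h, ballotSumConcatZero_succ_succ a b x h]
    simp only [map_add, map_mul]
    ring

end Row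

/-! ### The expansion -/

section Expansion

open PowerSeries

variable {R : Type*} [CommRing R] (a : Rˣ) (b x : R) (r n : ℕ)

/-- The `n`-th summand of the expansion of `z`, with parameters in an arbitrary commutative ring
and the element `c` in place of `E_n(x)`. -/
noncomputable def summand (c : R) : R⟦X⟧ :=
  divSeries (C (((a⁻¹ ^ n.choose 2 : Rˣ) : R) * c) * X ^ n)
    ((∏ i ∈ Finset.Icc 1 n, (1 + C ((a⁻¹ ^ i : Rˣ) : R) * X)) *
      ∏ i ∈ Finset.Icc 1 (r * n), (1 + C (x * b ^ i) * X))

theorem summand_eq_mul (c : R) :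
    summand a b x r n c = C c * X ^ n * (C ((a⁻¹ ^ n.choose 2 : Rˣ) : R) *
      (invProd (fun i => ((a⁻¹ ^ i : Rˣ) : R)) n * invProd (fun i => x * b ^ i) (r * n))) := by
  rw [summand, divSeries_prod_mul_prod, map_mul]
  ring

theorem X_pow_dvd_summand (c : R) : X ^ n ∣ summand a b x r n c := by
  rw [summand_eq_mul]
  exact dvd_mul_of_dvd_left (dvd_mul_left _ _) _

/-- The factor `a ^ (-(n+1 choose 2)) * z ^ n / ((1 + a⁻¹ z) ⋯ (1 + a⁻ⁿ z))` of the remainder of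
the expansion after `n` summands. -/
noncomputable def rowSeries : R⟦X⟧ :=
  C ((a⁻¹ ^ (n + 1).choose 2 : Rˣ) : R) * X ^ n * invProd (fun i => ((a⁻¹ ^ i : Rˣ) : R)) n

theorem rowSeries_zero : rowSeries a 0 = 1 := by
  simp [rowSeries, invProd_zero]

theorem C_pow_mul_C_inv_pow_choose :
    (C ((a : R) ^ (n + 1)) * C ((a⁻¹ ^ (n + 2).choose 2 : Rˣ) : R) : R⟦X⟧) =
      C ((a⁻¹ ^ (n + 1).choose 2 : Rˣ) : R) := by
  rw [← map_mul, Nat.choose_succ_succ' (n + 1) 1, Nat.choose_one_right,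
    pow_add a⁻¹ (n + 1), Units.val_mul, ← mul_assoc, ← Units.val_pow_eq_pow_val,
    ← Units.val_mul, ← mul_pow, mul_inv_cancel, one_pow, Units.val_one, one_mul]

theorem X_mul_rowSeries :
    X * rowSeries a n = (X + C ((a : R) ^ (n + 1))) * rowSeries a (n + 1) := by
  have hfactor : (X + C ((a : R) ^ (n + 1)) : R⟦X⟧) =
      C ((a : R) ^ (n + 1)) * (1 + C ((a⁻¹ ^ (n + 1) : Rˣ) : R) * X) := by
    rw [mul_add, ← mul_assoc, ← map_mul]
    simp [← mul_pow, add_comm]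
  rw [rowSeries, rowSeries, ← invProd_succ_mul, ← C_pow_mul_C_inv_pow_choose, hfactor]
  ring

theorem summand_succ (c : R) :
    summand a b x r (n + 1) c = C ((a : R) ^ (n + 1)) * C c *
      invProd (fun i => x * b ^ i) (r * (n + 1)) * rowSeries a (n + 1) := by
  rw [summand_eq_mul, rowSeries, ← C_pow_mul_C_inv_pow_choose]
  ring


/-- With `S i = rowSum (a : R) b x r i (r * i)`, the summand `i + 1` equals
`X * rowSeries a i * S i - X * rowSeries a (i + 1) * S (i + 1)`, so the sum telescopes. -/
theorem sum_summand_dyckSum_add :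
    ∑ k ∈ Finset.range n, summand a b x r (k + 1) (dyckSum (a : R) b x r (k + 1)) +
      X * rowSeries a n * rowSum (a : R) b x r n (r * n) = X := by
  induction n with
  | zero => simp [rowSeries_zero, rowSum_zero_right]
  | succ n ih =>
    have hrow := X_mul_rowSum_succ (a : R) b x (i := n) (m := r * (n + 1)) le_rfl
    rw [rowSum_eq_of_le _ _ _ (Nat.mul_le_mul_left r n.le_succ), ← dyckSum_eq_ballotSum] at hrow
    rw [Finset.sum_range_succ, summand_succ, add_assoc]
    conv_rhs => rw [← ih, X_mul_rowSeries]
    linear_combination rowSeries a (n + 1) * hrow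

theorem hasFormalSum_summand_dyckSum :
    HasFormalSum (fun k => summand a b x r (k + 1) (dyckSum (a : R) b x r (k + 1))) X := by
  rw [hasFormalSum_iff fun k => X_pow_dvd_summand a b x r (k + 1) _]
  intro d
  have hremainder : (X : R⟦X⟧) ^ (d + 1) ∣ X * rowSeries a d * rowSum (a : R) b x r d (r * d) :=
    ⟨C ((a⁻¹ ^ (d + 1).choose 2 : Rˣ) : R) * invProd (fun i => ((a⁻¹ ^ i : Rˣ) : R)) d *
      rowSum (a : R) b x r d (r * d), by rw [rowSeries]; ring⟩
  conv_rhs => rw [← sum_summand_dyckSum_add a b x r d]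
  rw [map_add, map_sum, X_pow_dvd_iff.mp hremainder d d.lt_succ_self, add_zero]

theorem hasFormalSum_summand_iff {e : ℕ → R} (he : e 0 = 1) :
    HasFormalSum (fun k => summand a b x r (k + 1) (e (k + 1))) X ↔
      ∀ n, e n = dyckSum (a : R) b x r n := by
  constructor
  · intro h
    have heq : (fun k => e (k + 1)) = fun k => dyckSum (a : R) b x r (k + 1) := by
      refine HasFormalSum.eq_of_isRegular (s := X) (fun k => ?_)
        (by simpa only [summand_eq_mul] using h)
        (by simpa only [summand_eq_mul] using hasFormalSum_summand_dyckSum a b x r)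
      simpa [constantCoeff_invProd] using ((a⁻¹ ^ (k + 1).choose 2).isUnit).isRegular
    rintro (_ | n)
    · rw [he, dyckSum_zero]
    · exact congrFun heq n
  · intro h
    simpa only [h] using hasFormalSum_summand_dyckSum a b x r

end Expansion

/-! ### The generating function -/

section GenFun

open Polynomial

variable {K : Type*} [CommRing K] {r : ℕ}

theorem genFun_eq_dyckSum (r n : ℕ) (a b : K) :
    genFun r n a b = dyckSum (C a) (C b) X r n := by
  simp only [genFun, dyckSum, map_pow]

theorem scaleVar_genFun (c : K) (r n : ℕ) (a b : K) :
    scaleVar c (genFun r n a b) = dyckSum (C a) (C b) (C c * X) r n := by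
  simp [scaleVar, genFun, dyckSum]

theorem genFun_zero (r : ℕ) (a b : K) : genFun r 0 a b = 1 := by
  rw [genFun_eq_dyckSum, dyckSum_zero]

theorem genFun_satisfiesRecurrence (r : ℕ) (a b : K) :
    SatisfiesRecurrence r a b fun n => genFun r n a b := by
  intro n
  simp only [scaleVar_genFun]
  simp only [genFun_eq_dyckSum, dyckSum_succ, map_mul, map_pow]

theorem SatisfiesRecurrence.unique {a b : K} {E E' : ℕ → K[X]}
    (h : SatisfiesRecurrence r a b E) (h' : SatisfiesRecurrence r a b E') (h0 : E 0 = E' 0)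
    (n : ℕ) : E n = E' n := by
  induction n using Nat.strong_induction_on with
  | _ n ih =>
    obtain _ | n := n
    · exact h0
    rw [h n, h' n]
    refine Finset.sum_congr rfl fun m hm => ?_
    have hlt (i) : m i < n + 1 := by
      rw [← Finset.Nat.mem_antidiagonalTuple.mp hm, Nat.lt_succ_iff]
      exact Finset.single_le_sum (fun _ _ => Nat.zero_le _) (Finset.mem_univ i)
    simp only [fun i => ih (m i) (hlt i)]

theorem satisfiesRecurrence_iff {a b : K} {E : ℕ → K[X]} (hE : E 0 = 1) :
    SatisfiesRecurrence r a b E ↔ ∀ n, E n = genFun r n a b := by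
  constructor
  · intro h
    exact h.unique (genFun_satisfiesRecurrence r a b) (by rw [hE, genFun_zero])
  · intro h
    rw [funext h]
    exact genFun_satisfiesRecurrence r a b

theorem expansionTerm_eq_summand (r n : ℕ) (a : Kˣ) (b : K) (E : ℕ → K[X]) :
    expansionTerm r a b E n = summand (Units.map (C : K →+* K[X]) a) (C b) X r n (E n) := by
  simp only [expansionTerm, expansionDenom, summand, ← map_inv, ← map_pow, Units.coe_map,
    MonoidHom.coe_coe]

theorem satisfiesExpansion_iff {a : Kˣ} {b : K} {E : ℕ → K[X]} (hE : E 0 = 1) :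
    SatisfiesExpansion r a b E ↔ ∀ n, E n = genFun r n (a : K) b := by
  simp only [SatisfiesExpansion, expansionTerm_eq_summand, hasFormalSum_summand_iff _ _ _ _ hE,
    genFun_eq_dyckSum, Units.coe_map, MonoidHom.coe_coe]

end GenFun

/-! ### The major index -/

section Maj

variable {K : Type*} [CommRing K]

theorem maj_eq_alpha_add_beta (w : List (Fin 2)) : maj w = alpha w + beta w := by
  rw [maj, alpha, beta, ← Finset.sum_add_distrib]
  refine Finset.sum_congr rfl fun i hi => ?_
  have hlt : i < w.length := (Finset.mem_Ico.mp (Finset.mem_filter.mp hi).1).2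
  rw [← length_eq_count_add_count, List.length_take_of_le hlt.le]

theorem dyckSum_self_self_one (q : K) (r n : ℕ) :
    dyckSum q q 1 r n = ∑ d ∈ dyckPaths r n, q ^ maj d := by
  simp only [dyckSum, maj_eq_alpha_add_beta, one_pow, one_mul, pow_add]

theorem eval_one_genFun (r n : ℕ) (q : K) :
    (genFun r n q q).eval 1 = ∑ d ∈ dyckPaths r n, q ^ maj d := by
  simp [genFun, Polynomial.eval_finsetSum, maj_eq_alpha_add_beta, pow_add]

open PowerSeries

theorem qPochhammer_neg_C_mul_X (c q : K) (n : ℕ) :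
    qPochhammer (-(C c * X)) (C q) n = ∏ i ∈ Finset.range n, (1 + C (q ^ i * c) * X) := by
  simp only [qPochhammer, map_mul, map_pow, mul_neg, sub_neg_eq_add, mul_assoc]

theorem qPochhammer_neg_self (q : K) (n : ℕ) :
    qPochhammer (-(C q * X)) (C q) n = ∏ i ∈ Finset.Icc 1 n, (1 + C (q ^ i) * X) := by
  rw [qPochhammer_neg_C_mul_X, ← Finset.Ico_add_one_right_eq_Icc, Finset.prod_Ico_eq_prod_range,
    Nat.add_sub_cancel]
  simp only [pow_add, pow_one, mul_comm q]

theorem qPochhammer_neg_inv_pow (q : Kˣ) (n : ℕ) :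
    qPochhammer (-(C ((q⁻¹ ^ n : Kˣ) : K) * X)) (C (q : K)) n =
      ∏ i ∈ Finset.Icc 1 n, (1 + C ((q⁻¹ ^ i : Kˣ) : K) * X) := by
  rw [qPochhammer_neg_C_mul_X, ← Finset.prod_range_reflect, ← Finset.Ico_add_one_right_eq_Icc,
    Finset.prod_Ico_eq_prod_range, Nat.add_sub_cancel]
  refine Finset.prod_congr rfl fun i hi => ?_
  have hpow : q ^ (n - 1 - i) * q⁻¹ ^ n = q⁻¹ ^ (1 + i) := by
    have hn : n = (n - 1 - i) + (1 + i) := by have := Finset.mem_range.mp hi; omega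
    nth_rw 2 [hn]
    rw [pow_add, ← mul_assoc, ← mul_pow, mul_inv_cancel, one_pow, one_mul]
  rw [← hpow, Units.val_mul, Units.val_pow_eq_pow_val q]

theorem satisfiesQExpansion_iff {r : ℕ} {q : Kˣ} {e : ℕ → K} (he : e 0 = 1) :
    SatisfiesQExpansion r q e ↔ ∀ n, ∑ d ∈ dyckPaths r n, (q : K) ^ maj d = e n := by
  have hsummand := hasFormalSum_summand_iff q (q : K) 1 r he
  simp only [summand, one_mul, dyckSum_self_self_one] at hsummand
  simp only [SatisfiesQExpansion, qPochhammer_neg_self, qPochhammer_neg_inv_pow, hsummand,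
    eq_comm]

end Maj

end RDyck

theorem mainTheorem11 {K : Type*} [CommRing K] (r : ℕ) (hr : 1 ≤ r) :
    (∀ (a : Kˣ) (b : K) (E : ℕ → Polynomial K), E 0 = 1 →
      List.TFAE [
        ∀ n, E n = RDyck.genFun r n (a : K) b,
        RDyck.SatisfiesExpansion r a b E,
        RDyck.SatisfiesRecurrence r (a : K) b E]) ∧
    (∀ (q : Kˣ) (e : ℕ → K), e 0 = 1 →
      (RDyck.SatisfiesQExpansion r q e ↔
        ∀ n, ∑ d ∈ RDyck.dyckPaths r n, (q : K) ^ RDyck.maj d = e n)) ∧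
    (∀ (q : K) (n : ℕ),
      (RDyck.genFun r n q q).eval 1 =
        ∑ d ∈ RDyck.dyckPaths r n, q ^ RDyck.maj d) := by
  refine ⟨fun a b E hE => ?_, fun q e he => RDyck.satisfiesQExpansion_iff he,
    fun q n => RDyck.eval_one_genFun r n q⟩
  tfae_have 2 ↔ 1 := RDyck.satisfiesExpansion_iff hE
  tfae_have 3 ↔ 1 := RDyck.satisfiesRecurrence_iff hE
  tfae_finish
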